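/- Let $A$ and $B$ be complex unital Banach algebras, and suppose that $A$ is semisimple, i.e. its Jacobson radical is $\{0\}$. Let $T\colon A\to B$ be a surjective additive map that preserves the spectral radius, i.e. $T(x+y)=T(x)+T(y)$ for all $x,y\in A$ and $r(Tx)=r(x)$ for all $x\in A$, where $r(x)=\sup\{|\lambda| : \lambda\in\sigma(x)\}$ denotes the spectral radius of $x$. Then $T$ is continuous, and it is real-linear, that is, $T(cx)=c\,T(x)$ for all $c\in\mathbb{R}$ and $x\in A$. -/

import Mathlib

/-!
Two facts about the spectral radius `r` carry the proof. It is subharmonic along holomorphic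
families (`spectralRadius_le_of_sphere`, `spectralRadius_sq_le_of_circles`,
`spectralRadius_le_of_ae_circle`), because `r (a)` is the limit of `‖a ^ n‖ ^ (1 / n)` and the
powers of a holomorphic family are holomorphic. It also detects the Jacobson radical: if
`r (a + q) = 0` for every `q` with `r (q) = 0`, then `a` is in the radical
(`mem_jacobson_of_spectralRadius_add_eq_zero`). The second fact gives injectivity of `T` at once and
reduces every identity `b = 0` in `B` to showing `r (b + w) = 0` for all quasi-nilpotent `w`.

*Real-linearity.* For `b = T (c x) - c T x` one has to bound `r (T y + s T x)` for real `s` when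
`y + s x` is quasi-nilpotent, although `T` only controls rational multiples. The map
`D z = T⁻¹ (z T x) - Re z • x - Im z • T⁻¹ (i T x)` is additive and vanishes on the Gaussian
rationals. It need not be measurable, but ergodicity of the translations by a dense subgroup shows
that every compact set on which `‖D‖` is bounded away from `0` is null
(`volume_eq_zero_of_lt_norm_addMonoidHom`). The set of `z` near `s` where `r (T y + z T x) ≥ ε` is of
this kind, so some circles around `s` meet it in a null set, and Jensen's formula bounds the spectral
radius at the centre `s`.

*Continuity.* By the closed graph theorem it suffices that `x n → 0` and `T (x n) → b` imply `b = 0`.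
For a quasi-nilpotent `w`, the affine map `q z = w + b - T (x n) + z T (x n)` takes the value `w + b`
at `1`. It has small spectral radius on a small disc, since there it is close to `w`. For real `z`,
`q z` is the image of an element bounded independently of `n`, on intervals growing with `n`; the
substitution `z = (R / 2) (ζ + ζ⁻¹)` turns this into a bound on a large complex disc
(`spectralRadius_add_smul_le_of_real`). The three circles theorem then forces `r (w + b) = 0`.
-/

/-! ### Subharmonicity of the spectral radius -/

section SpectralRadius

open Filter Topology Metric Complex
open scoped ENNReal NNReal
variable {A : Type*} [NormedRing A] [NormedAlgebra ℂ A] [CompleteSpace A]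

theorem spectralRadius_le_enorm (a : A) : spectralRadius ℂ a ≤ ‖a‖₊ := by
  refine le_of_tendsto (spectrum.pow_nnnorm_pow_one_div_tendsto_nhds_spectralRadius a) ?_
  filter_upwards [eventually_ge_atTop 1] with n hn
  calc ((‖a ^ n‖₊ : ℝ≥0) : ℝ≥0∞) ^ (1 / n : ℝ) ≤ ((‖a‖₊ : ℝ≥0∞) ^ n) ^ (1 / n : ℝ) := by
        gcongr
        exact_mod_cast nnnorm_pow_le' a hn
    _ = ‖a‖₊ := by
        rw [← ENNReal.rpow_natCast, ← ENNReal.rpow_mul, mul_one_div_cancel (by positivity),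
          ENNReal.rpow_one]

theorem spectralRadius_le_of_nnnorm_pow_le {a : A} {m : ℕ} (hm : m ≠ 0) {M : ℝ≥0}
    (h : ‖a ^ m‖₊ ≤ M ^ m) : spectralRadius ℂ a ≤ M := by
  rw [← ENNReal.pow_le_pow_left_iff hm]
  exact (spectrum.spectralRadius_pow_le a m hm).trans
    ((spectralRadius_le_enorm _).trans (by exact_mod_cast h))

theorem eventually_nnnorm_pow_lt {a : A} {M : ℝ≥0} (h : spectralRadius ℂ a < M) :
    ∀ᶠ n : ℕ in atTop, ‖a ^ n‖₊ < M ^ n := by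
  filter_upwards [(spectrum.pow_nnnorm_pow_one_div_tendsto_nhds_spectralRadius a).eventually_lt_const
    h, eventually_ge_atTop 1] with n hn hn1
  have h1 := ENNReal.pow_lt_pow_left (n := n) (by lia) hn
  rw [← ENNReal.rpow_natCast, ← ENNReal.rpow_mul, one_div_mul_cancel (by positivity),
    ENNReal.rpow_one] at h1
  exact_mod_cast h1

theorem eventually_spectralRadius_lt {a : A} {c : ℝ≥0∞} (h : spectralRadius ℂ a < c) :
    ∀ᶠ b in 𝓝 a, spectralRadius ℂ b < c := by
  obtain ⟨M, hM, hMc⟩ := ENNReal.lt_iff_exists_nnreal_btwn.1 h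
  obtain ⟨n, hn, hn1⟩ := ((eventually_nnnorm_pow_lt hM).and (eventually_ge_atTop 1)).exists
  have : ∀ᶠ b in 𝓝 a, ‖b ^ n‖₊ < M ^ n :=
    (continuous_nnnorm.comp (continuous_pow n)).continuousAt.eventually_lt continuousAt_const hn
  filter_upwards [this] with b hb
  exact (spectralRadius_le_of_nnnorm_pow_le (by lia) hb.le).trans_lt hMc

theorem isOpen_spectralRadius_lt (c : ℝ≥0∞) : IsOpen {a : A | spectralRadius ℂ a < c} :=
  isOpen_iff_mem_nhds.2 fun _ h => eventually_spectralRadius_lt h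

theorem spectralRadius_smul (c : ℂ) (a : A) :
    spectralRadius ℂ (c • a) = ‖c‖₊ * spectralRadius ℂ a := by
  refine tendsto_nhds_unique (spectrum.pow_nnnorm_pow_one_div_tendsto_nhds_spectralRadius _)
    ((ENNReal.Tendsto.const_mul
      (spectrum.pow_nnnorm_pow_one_div_tendsto_nhds_spectralRadius a)
        (Or.inr ENNReal.coe_ne_top)).congr' ?_)
  filter_upwards [eventually_ge_atTop 1] with n hn
  rw [smul_pow, nnnorm_smul, nnnorm_pow c, ENNReal.coe_mul, ENNReal.mul_rpow_of_nonneg _ _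
    (by positivity), ENNReal.coe_pow, ← ENNReal.rpow_natCast, ← ENNReal.rpow_mul,
    mul_one_div_cancel (by positivity), ENNReal.rpow_one]

theorem spectralRadius_smul_eq_zero (c : ℂ) {a : A} (h : spectralRadius ℂ a = 0) :
    spectralRadius ℂ (c • a) = 0 := by
  rw [spectralRadius_smul, h, mul_zero]

/-- Submultiplicativity of the norm and compactness turn a pointwise bound for the spectral radius
along a continuous family into a norm bound for one common power. -/
theorem IsCompact.exists_pow_nnnorm_lt {X : Type*} [TopologicalSpace X] {K : Set X}
    (hK : IsCompact K) {f : X → A} (hf : ContinuousOn f K) {M : ℝ≥0}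
    (h : ∀ x ∈ K, spectralRadius ℂ (f x) < M) :
    ∃ N : ℕ, ∀ k ≥ N, ∀ x ∈ K, ‖f x ^ (2 ^ k)‖₊ < M ^ (2 ^ k) := by
  have step : ∀ (a : A) (j k : ℕ), j ≤ k → ‖a ^ (2 ^ j)‖₊ < M ^ (2 ^ j) →
      ‖a ^ (2 ^ k)‖₊ < M ^ (2 ^ k) := by
    intro a j k hjk hj
    induction k, hjk using Nat.le_induction with
    | base => exact hj
    | succ k _ ih =>
      rw [pow_succ 2 k, pow_mul, pow_mul]
      exact (nnnorm_pow_le' _ two_pos).trans_lt (pow_lt_pow_left₀ ih (zero_le) two_ne_zero)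
  refine hK.induction_on (p := fun S => ∃ N : ℕ, ∀ k ≥ N, ∀ x ∈ S,
    ‖f x ^ (2 ^ k)‖₊ < M ^ (2 ^ k)) ⟨0, by simp⟩ ?_ ?_ ?_
  · rintro s t hst ⟨N, hN⟩
    exact ⟨N, fun k hk x hx => hN k hk x (hst hx)⟩
  · rintro s t ⟨N, hN⟩ ⟨N', hN'⟩
    refine ⟨max N N', fun k hk x hx => hx.elim (hN k (le_trans (le_max_left _ _) hk) x)
      (hN' k (le_trans (le_max_right _ _) hk) x)⟩
  · intro x hx
    obtain ⟨N, hN⟩ := ((tendsto_pow_atTop_atTop_of_one_lt (one_lt_two (α := ℕ))).eventually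
      (eventually_nnnorm_pow_lt (h x hx))).exists
    refine ⟨_, ((hf.pow (2 ^ N)).nnnorm x hx).eventually_lt continuousWithinAt_const hN,
      N, fun k hk y hy => step _ _ _ hk hy⟩

theorem spectralRadius_le_of_sphere {f : ℂ → A} {c z : ℂ} {R : ℝ} (hR : R ≠ 0)
    (hf : DiffContOnCl ℂ f (ball c R)) {M : ℝ≥0}
    (h : ∀ w ∈ sphere c R, spectralRadius ℂ (f w) < M) (hz : z ∈ closedBall c R) :
    spectralRadius ℂ (f z) ≤ M := by
  obtain ⟨N, hN⟩ := (isCompact_sphere c R).exists_pow_nnnorm_lt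
    (hf.continuousOn_ball.mono sphere_subset_closedBall) h
  have hd : DiffContOnCl ℂ (fun w => f w ^ 2 ^ N) (ball c R) :=
    ⟨hf.differentiableOn.pow _, hf.continuousOn.pow _⟩
  refine spectralRadius_le_of_nnnorm_pow_le (m := 2 ^ N) (by positivity) ?_
  have := norm_le_of_forall_mem_frontier_norm_le isBounded_ball hd (C := (M : ℝ) ^ 2 ^ N)
    (fun w hw => ?_) (z := z) (by rwa [closure_ball c hR])
  · exact_mod_cast this
  · rw [frontier_ball c hR] at hw
    exact_mod_cast (hN N le_rfl w hw).le

/-- Three circles theorem for the spectral radius, at the geometric mean of the radii. -/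
theorem spectralRadius_sq_le_of_circles {q : ℂ → A} (hq : Differentiable ℂ q) {ρ : ℝ} (hρ : 1 < ρ)
    {α β : ℝ≥0} (hα : ∀ z : ℂ, ‖z‖ = ρ⁻¹ → spectralRadius ℂ (q z) < α)
    (hβ : ∀ z : ℂ, ‖z‖ = ρ → spectralRadius ℂ (q z) < β) :
    spectralRadius ℂ (q 1) ^ 2 ≤ α * β := by
  have hρ0 : 0 < ρ := by linarith
  obtain ⟨N, hN⟩ := (isCompact_sphere (0 : ℂ) ρ⁻¹).exists_pow_nnnorm_lt
    hq.continuous.continuousOn (fun z hz => hα z (by simpa using hz))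
  obtain ⟨N', hN'⟩ := (isCompact_sphere (0 : ℂ) ρ).exists_pow_nnnorm_lt
    hq.continuous.continuousOn (fun z hz => hβ z (by simpa using hz))
  set m := 2 ^ max N N' with hm
  have hm0 : m ≠ 0 := by positivity
  have key := HadamardThreeLines.norm_le_interp_of_mem_verticalClosedStrip' (l := -1) (u := 1)
    (f := fun s : ℂ => q (exp (s * Real.log ρ)) ^ m) (z := 0) (a := (α : ℝ) ^ m) (b := (β : ℝ) ^ m)
    (by norm_num) (by simp [HadamardThreeLines.verticalClosedStrip])
    (by
      have : Differentiable ℂ fun s : ℂ => q (exp (s * Real.log ρ)) ^ m := by fun_prop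
      exact this.diffContOnCl)
    (by
      refine ((isCompact_closedBall (0 : ℂ) ρ).image_of_continuousOn
        (f := fun z => ‖q z ^ m‖) (by have := hq.continuous; fun_prop)).bddAbove.mono ?_
      rintro _ ⟨s, hs, rfl⟩
      refine ⟨exp (s * Real.log ρ), ?_, rfl⟩
      have h1 : s.re ≤ 1 := hs.2
      rw [mem_closedBall_zero_iff, norm_exp, re_mul_ofReal]
      calc Real.exp (s.re * Real.log ρ) ≤ Real.exp (1 * Real.log ρ) := by
            gcongr
            exact (Real.log_pos hρ).le
        _ = ρ := by rw [one_mul, Real.exp_log hρ0])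
    (fun s hs => by
      refine (NNReal.coe_lt_coe.2 (hN _ (le_max_left _ _) _ ?_)).le
      rw [mem_sphere_zero_iff_norm, norm_exp, re_mul_ofReal, show s.re = -1 from hs, neg_one_mul,
        Real.exp_neg, Real.exp_log hρ0])
    (fun s hs => by
      refine (NNReal.coe_lt_coe.2 (hN' _ (le_max_right _ _) _ ?_)).le
      rw [mem_sphere_zero_iff_norm, norm_exp, re_mul_ofReal, show s.re = 1 from hs, one_mul,
        Real.exp_log hρ0])
  have key2 : ‖q 1 ^ m‖ ^ 2 ≤ (α * β : ℝ) ^ m := by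
    have h0 : ‖q 1 ^ m‖ ≤ √((α : ℝ) ^ m) * √((β : ℝ) ^ m) := by
      rw [Real.sqrt_eq_rpow, Real.sqrt_eq_rpow]
      simpa only [zero_mul, exp_zero, zero_re, sub_neg_eq_add, zero_add, one_add_one_eq_two,
        show (1 : ℝ) - 1 / 2 = 1 / 2 by norm_num] using key
    calc ‖q 1 ^ m‖ ^ 2 ≤ (√((α : ℝ) ^ m) * √((β : ℝ) ^ m)) ^ 2 := by gcongr
      _ = _ := by rw [mul_pow, Real.sq_sqrt (by positivity), Real.sq_sqrt (by positivity), mul_pow]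
  rw [← ENNReal.pow_le_pow_left_iff hm0, ← pow_mul, mul_comm 2 m, pow_mul]
  calc (spectralRadius ℂ (q 1) ^ m) ^ 2 ≤ ((‖q 1 ^ m‖₊ : ℝ≥0) : ℝ≥0∞) ^ 2 := by
        gcongr
        exact (spectrum.spectralRadius_pow_le _ m hm0).trans (spectralRadius_le_enorm _)
    _ ≤ ((α : ℝ≥0∞) * β) ^ m := by exact_mod_cast key2

/-- Jensen's inequality for a holomorphic function with values in a normed space. The positive part
`log⁺` on the right makes the integrand continuous, so the zeros of `f` need no separate treatment.
-/
theorem log_norm_le_circleAverage_posLog {E : Type*} [NormedAddCommGroup E] [NormedSpace ℂ E]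
    {f : ℂ → E} (hf : Differentiable ℂ f) {c : ℂ} {R : ℝ} (hR : 0 < R) (h0 : f c ≠ 0) :
    Real.log ‖f c‖ ≤ Real.circleAverage (fun z => Real.posLog ‖f z‖) c R := by
  obtain ⟨φ, hφ, hφc⟩ := exists_dual_vector'' ℂ (f c)
  have hg : Differentiable ℂ fun z => φ (f z) := φ.differentiable.comp hf
  have hga : AnalyticOnNhd ℂ (fun z => φ (f z)) (closedBall c |R|) :=
    fun z _ => hg.analyticAt z
  have hgc : φ (f c) ≠ 0 := by rw [hφc]; simpa using h0
  have hJ := AnalyticOnNhd.circleAverage_log_norm hR.ne' hga hgc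
  have hnn : 0 ≤ ∑ᶠ u, (MeromorphicOn.divisor (fun z => φ (f z)) (closedBall c |R|) u : ℝ) *
      Real.log (R * ‖c - u‖⁻¹) := by
    refine finsum_nonneg fun u => ?_
    by_cases hu : u ∈ closedBall c |R|
    · refine mul_nonneg ?_ ?_
      · exact_mod_cast MeromorphicOn.AnalyticOnNhd.divisor_nonneg hga u
      · rcases eq_or_ne u c with rfl | huc
        · simp
        · refine Real.log_nonneg ?_
          rw [mem_closedBall, dist_comm, dist_eq_norm, abs_of_pos hR] at hu
          have : 0 < ‖c - u‖ := norm_pos_iff.2 (sub_ne_zero.2 huc.symm)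
          rwa [← div_eq_mul_inv, one_le_div this]
    · simp [hu]
  have hnc : Real.log ‖φ (f c)‖ = Real.log ‖f c‖ := by rw [hφc]; simp
  rw [hnc] at hJ
  calc Real.log ‖f c‖ ≤ Real.circleAverage (fun z => Real.log ‖φ (f z)‖) c R := by rw [hJ]; linarith
    _ ≤ _ := by
      refine Real.circleAverage_mono ?_ ?_ ?_
      · exact (hga.meromorphicOn.mono_set sphere_subset_closedBall).circleIntegrable_log_norm
      · refine ContinuousOn.circleIntegrable' ?_
        have := hf.continuous
        exact (Real.continuous_posLog.comp this.norm).continuousOn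
      · intro z hz
        have h1 : ‖φ (f z)‖ ≤ ‖f z‖ := 
          (φ.le_opNorm (f z)).trans (mul_le_of_le_one_left (norm_nonneg _) hφ)
        exact (le_max_right 0 (Real.log ‖φ (f z)‖)).trans (Real.posLog_le_posLog (norm_nonneg _) h1)

/-- Since `log ∘ spectralRadius` is subharmonic along holomorphic functions, a bound almost
everywhere on a circle is inherited by the centre. -/
theorem spectralRadius_le_of_ae_circle {f : ℂ → A} (hf : Differentiable ℂ f) {c : ℂ} {R : ℝ}
    (hR : 0 < R) {M : ℝ≥0} (hM : 0 < M)
    (h : ∀ᵐ θ : ℝ, θ ∈ Set.Ioc 0 (2 * Real.pi) → spectralRadius ℂ (f (circleMap c R θ)) < M) :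
    spectralRadius ℂ (f c) ≤ M := by
  wlog hM1 : M = 1 generalizing f M
  · have hs : ∀ a : A, spectralRadius ℂ ((M⁻¹ : ℂ) • a) = (M : ℝ≥0∞)⁻¹ * spectralRadius ℂ a := by
      intro a
      rw [spectralRadius_smul, nnnorm_inv, ENNReal.coe_inv (by simpa using hM.ne')]
      simp
    have h0 : (M : ℝ≥0∞) ≠ 0 := by exact_mod_cast hM.ne'
    have := this (f := fun z => (M⁻¹ : ℂ) • f z) (hf.const_smul (M⁻¹ : ℂ)) one_pos (by
      filter_upwards [h] with θ hθ hθ'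
      rw [hs, mul_comm, ← div_eq_mul_inv, ENNReal.coe_one]
      exact ENNReal.div_lt_of_lt_mul (by simpa using hθ hθ')) rfl
    rw [hs, mul_comm, ← div_eq_mul_inv, ENNReal.coe_one,
      ENNReal.div_le_iff h0 ENNReal.coe_ne_top, one_mul] at this
    exact this
  subst hM1
  by_contra! hlt
  obtain ⟨L, hL1, hL⟩ := ENNReal.lt_iff_exists_nnreal_btwn.1 hlt
  have hL1' : (1 : ℝ) < L := by exact_mod_cast hL1
  have hpow : ∀ m : ℕ, m ≠ 0 → (L : ℝ) ^ m < ‖f c ^ m‖ := by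
    intro m hm
    by_contra! hle
    exact absurd (spectralRadius_le_of_nnnorm_pow_le hm (by exact_mod_cast hle)) hL.not_ge
  have hcont := hf.continuous
  have hlow : ∀ m : ℕ, m ≠ 0 → Real.log L ≤
      Real.circleAverage (fun z => (m : ℝ)⁻¹ * Real.posLog ‖f z ^ m‖) c R := by
    intro m hm
    have hp := hpow m hm
    have hne : f c ^ m ≠ 0 := norm_pos_iff.1 (lt_trans (by positivity) hp)
    have h1 := log_norm_le_circleAverage_posLog (f := fun z => f z ^ m) (hf.pow m) hR hne
    have h2 : m * Real.log L ≤ Real.log ‖f c ^ m‖ := by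
      rw [← Real.log_pow]
      exact Real.log_le_log (by positivity) hp.le
    have hm' : (0 : ℝ) < m := by positivity
    change _ ≤ Real.circleAverage (fun z => (m : ℝ)⁻¹ • Real.posLog ‖f z ^ m‖) c R
    rw [show (fun z => (m : ℝ)⁻¹ • Real.posLog ‖f z ^ m‖) =
      (m : ℝ)⁻¹ • fun z => Real.posLog ‖f z ^ m‖ from rfl, Real.circleAverage_smul, smul_eq_mul,
      le_inv_mul_iff₀ hm']
    exact h2.trans h1
  -- Almost everywhere on the circle the powers of `f z` tend to zero, so `log⁺` eventually vanishes.
  have hlim : Tendsto (fun m : ℕ => Real.circleAverage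
      (fun z => (m : ℝ)⁻¹ * Real.posLog ‖f z ^ m‖) c R) atTop (𝓝 0) := by
    have hz : (0 : ℝ) = (2 * Real.pi)⁻¹ • ∫ θ in (0 : ℝ)..2 * Real.pi, (0 : ℝ) := by simp
    rw [hz]
    refine Tendsto.const_smul (intervalIntegral.tendsto_integral_filter_of_dominated_convergence
      (fun θ => Real.posLog ‖f (circleMap c R θ)‖) ?_ ?_ ?_ ?_) _
    · refine .of_forall fun m => ?_
      have : Continuous fun θ => (m : ℝ)⁻¹ * Real.posLog ‖f (circleMap c R θ) ^ m‖ := by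
        refine continuous_const.mul (Real.continuous_posLog.comp ?_)
        exact ((hcont.comp (continuous_circleMap c R)).pow m).norm
      exact this.aestronglyMeasurable
    · filter_upwards [eventually_ge_atTop 1] with m hm
      refine .of_forall fun θ _ => ?_
      rw [Real.norm_of_nonneg (mul_nonneg (by positivity) Real.posLog_nonneg),
        inv_mul_le_iff₀ (by positivity), ← Real.posLog_pow]
      exact Real.posLog_le_posLog (norm_nonneg _) (norm_pow_le' _ hm)
    · refine Continuous.intervalIntegrable ?_ _ _
      exact Real.continuous_posLog.comp (hcont.comp (continuous_circleMap c R)).norm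
    · filter_upwards [h] with θ hθ hθ'
      rw [Set.uIoc_of_le (by positivity)] at hθ'
      refine tendsto_const_nhds.congr' ?_
      filter_upwards [eventually_nnnorm_pow_lt (hθ hθ')] with m hm
      have : ‖f (circleMap c R θ) ^ m‖ ≤ 1 := by
        simpa using (NNReal.coe_lt_coe.2 hm).le
      rw [(Real.posLog_eq_zero_iff _).2 (by simpa using this), mul_zero]
  have := ge_of_tendsto hlim ((eventually_ge_atTop 1).mono fun m hm => hlow m (by lia))
  exact absurd (Real.log_pos hL1') this.not_gt

end SpectralRadius

/-! ### Zemánek's characterisation of the radical -/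

section Radical

open Filter Topology Metric Complex
open scoped ENNReal NNReal

/-- Schur's lemma for the simple module `R ⧸ L`: a right multiplication that preserves `L` and is
nonzero on `R ⧸ L` is injective and surjective there. -/
theorem mul_right_quotient_bijective {R : Type*} [Ring R] {L : Ideal R} (hL : IsCoatom L) {c : R}
    (hLc : ∀ x ∈ L, x * c ∈ L) (hc : c ∉ L) :
    (∀ x, x * c ∈ L → x ∈ L) ∧ ∀ y, ∃ x, y - x * c ∈ L := by
  constructor
  · have hle : L ≤ Submodule.comap (LinearMap.toSpanSingleton R R c) L := fun x hx => hLc x hx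
    have hne : Submodule.comap (LinearMap.toSpanSingleton R R c) L ≠ ⊤ := by
      intro h
      have h1 : (1 : R) ∈ Submodule.comap (LinearMap.toSpanSingleton R R c) L := h ▸ Submodule.mem_top
      exact hc (by simpa using h1)
    intro x hx
    rw [← (hL.le_iff_eq hne).1 hle]
    exact hx
  · intro y
    have htop : L ⊔ Ideal.span {c} = ⊤ := hL.2 _ (by
      refine lt_of_le_of_ne le_sup_left fun h => hc ?_
      rw [h]
      exact Submodule.mem_sup_right (Ideal.mem_span_singleton_self c))
    obtain ⟨l, hl, z, hz, hlz⟩ := Submodule.mem_sup.1 (htop ▸ Submodule.mem_top (x := y))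
    obtain ⟨x, rfl⟩ := Ideal.mem_span_singleton'.1 hz
    exact ⟨x, by rwa [← hlz, add_sub_cancel_right]⟩

theorem eq_zero_of_sub_algebraMap_mem_of_spectralRadius_eq_zero
    {A : Type*} [NormedRing A] [NormedAlgebra ℂ A] {L : Ideal A} (hL : L ≠ ⊤) {b : A}
    (hb : spectralRadius ℂ b = 0) {μ : ℂ} (h : b - algebraMap ℂ A μ ∈ L) : μ = 0 := by
  by_contra hμ
  have h1 : μ ∈ resolventSet ℂ b :=
    spectrum.mem_resolventSet_of_spectralRadius_lt (by rw [hb]; simpa using hμ)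
  refine hL (Ideal.eq_top_of_isUnit_mem _ h ?_)
  rw [← IsUnit.neg_iff, neg_sub]
  exact spectrum.mem_resolventSet_iff.1 h1

variable {A : Type*} [NormedRing A] [NormedAlgebra ℂ A] [CompleteSpace A]

/-- The Gelfand–Mazur theorem for the endomorphism of the simple Banach module `A ⧸ L` induced by
right multiplication by an element of the idealizer of `L`: it is a scalar. -/
theorem exists_sub_algebraMap_mem {L : Ideal A} (hL : IsCoatom L) {a : A}
    (hLa : ∀ x ∈ L, x * a ∈ L) : ∃ μ : ℂ, a - algebraMap ℂ A μ ∈ L := by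
  have : L.IsMaximal := ⟨hL⟩
  let N : Submodule ℂ A := L.restrictScalars ℂ
  have hN : IsClosed (N : Set A) := Ideal.IsMaximal.isClosed (I := L)
  have hNa : N ≤ N.comap (LinearMap.mulRight ℂ a) := fun x hx => hLa x hx
  let D : (A ⧸ N) →L[ℂ] (A ⧸ N) :=
    ⟨N.mapQ N (LinearMap.mulRight ℂ a) hNa, by
      rw [N.isOpenQuotientMap_mkQ.isQuotientMap.continuous_iff]
      have : Continuous fun x : A => N.mkQ (x * a) :=
        N.isOpenQuotientMap_mkQ.continuous.comp (continuous_id.mul continuous_const)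
      exact this⟩
  have hntr : Nontrivial (A ⧸ N) := by
    refine Submodule.Quotient.nontrivial_iff.2 fun h => hL.1 ?_
    rw [Ideal.eq_top_iff_one]
    exact (h ▸ Submodule.mem_top : (1 : A) ∈ N)
  -- A spectral value `μ` of `D` works: otherwise `D - μ` would be bijective, hence invertible.
  obtain ⟨μ, hμ⟩ := spectrum.nonempty D
  refine ⟨μ, by_contra fun hc => hμ ?_⟩
  obtain ⟨hinj, hsurj⟩ := mul_right_quotient_bijective hL (c := a - algebraMap ℂ A μ)
    (fun x hx => by
      rw [mul_sub, ← Algebra.commutes]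
      exact L.sub_mem (hLa x hx) (L.mul_mem_left _ hx)) hc
  have hD : ∀ x : A, (algebraMap ℂ ((A ⧸ N) →L[ℂ] (A ⧸ N)) μ - D) (N.mkQ x) =
      - N.mkQ (x * (a - algebraMap ℂ A μ)) := by
    intro x
    have h1 : D (N.mkQ x) = N.mkQ (x * a) := rfl
    rw [sub_apply, h1, Algebra.algebraMap_eq_smul_one,
      Algebra.algebraMap_eq_smul_one, mul_sub, mul_smul_comm, mul_one, map_sub, map_smul]
    simp
  rw [spectrum.mem_resolventSet_iff, ContinuousLinearMap.isUnit_iff_bijective]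
  constructor
  · rw [injective_iff_map_eq_zero]
    intro y hy
    obtain ⟨x, rfl⟩ := N.mkQ_surjective y
    rw [hD, neg_eq_zero] at hy
    have h1 : x * (a - algebraMap ℂ A μ) ∈ N := by simpa using hy
    rw [Submodule.mkQ_apply, Submodule.Quotient.mk_eq_zero]
    exact hinj x h1
  · intro y
    obtain ⟨x, rfl⟩ := N.mkQ_surjective y
    obtain ⟨z, hz⟩ := hsurj x
    refine ⟨N.mkQ (-z), ?_⟩
    rw [hD, neg_mul, map_neg, neg_neg, eq_comm, ← sub_eq_zero, ← map_sub, Submodule.mkQ_apply,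
      Submodule.Quotient.mk_eq_zero]
    exact hz

/-- The commutator of `u` with `a` is the derivative at `0` of a family of differences of `a` and
its conjugates, which are quasi-nilpotent by hypothesis. -/
theorem spectralRadius_commutator_eq_zero {a : A}
    (h : ∀ q : A, spectralRadius ℂ q = 0 → spectralRadius ℂ (a + q) = 0) (u : A) :
    spectralRadius ℂ (u * a - a * u) = 0 := by
  have ha : spectralRadius ℂ a = 0 := by simpa using h 0 (by simp)
  set R : ℝ := (‖u‖ + 1)⁻¹ with hR
  have hR0 : 0 < R := by positivity
  have hsmall : ∀ z : ℂ, ‖z‖ ≤ R → ‖z • u‖ < 1 := by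
    intro z hz
    calc ‖z • u‖ ≤ R * ‖u‖ := by rw [norm_smul]; gcongr
      _ < 1 := by rw [hR, inv_mul_lt_one₀ (by positivity)]; linarith
  let g : ℂ → A := fun z => (u * a - a * u) * Ring.inverse (1 - z • u)
  have hg : DiffContOnCl ℂ g (ball 0 R) := by
    refine DifferentiableOn.diffContOnCl_ball (U := closedBall 0 R) (fun z hz => ?_) subset_rfl
    have hunit : IsUnit (1 - z • u) :=
      isUnit_one_sub_of_norm_lt_one (hsmall z (by simpa using hz))
    have h2 : DifferentiableAt ℂ (fun w : ℂ => 1 - w • u) z := by fun_prop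
    exact ((DifferentiableAt.comp z (differentiableAt_inverse hunit) h2).const_mul
      _).differentiableWithinAt
  have hqn : ∀ z ∈ sphere (0 : ℂ) R, spectralRadius ℂ (g z) = 0 := by
    intro z hz
    have hz' : ‖z‖ = R := by simpa using hz
    have hz0 : z ≠ 0 := norm_pos_iff.1 (hz' ▸ hR0)
    obtain ⟨v, hv⟩ : IsUnit (1 - z • u) := isUnit_one_sub_of_norm_lt_one (hsmall z hz'.le)
    have h1 : spectralRadius ℂ (-(v * a * (v⁻¹ : Aˣ)) : A) = 0 := by
      have h2 : spectralRadius ℂ (v * a * (v⁻¹ : Aˣ) : A) = 0 := by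
        rw [spectralRadius, spectrum.units_conjugate]; exact ha
      simpa using spectralRadius_smul_eq_zero (-1) h2
    have h3 : z • g z = a + -(v * a * (v⁻¹ : Aˣ) : A) := by
      have h4 : g z = (u * a - a * u) * (v⁻¹ : Aˣ) := by
        simp only [g]; rw [← hv, Ring.inverse_unit]
      have h5 : z • (u * a - a * u) = a * v - v * a := by
        rw [hv]; simp [mul_sub, sub_mul, smul_sub]
      rw [h4, ← smul_mul_assoc, h5, sub_mul, mul_assoc a, Units.mul_inv, mul_one, sub_eq_add_neg]
    have h6 := spectralRadius_smul_eq_zero z⁻¹ (h _ h1)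
    rwa [← h3, inv_smul_smul₀ hz0] at h6
  have hg0 : g 0 = u * a - a * u := by simp [g]
  rw [← hg0, ← nonpos_iff_eq_zero]
  refine ENNReal.le_of_forall_pos_le_add fun ε hε _ => ?_
  rw [zero_add]
  exact spectralRadius_le_of_sphere hR0.ne' hg
    (fun w hw => by rw [hqn w hw]; exact_mod_cast hε) (by simp [hR0.le])

/-- Zemánek's characterisation of the Jacobson radical (the nontrivial direction): an element whose
translates of quasi-nilpotent elements are quasi-nilpotent is in the radical. -/
theorem mem_jacobson_of_spectralRadius_add_eq_zero {a : A}
    (h : ∀ q : A, spectralRadius ℂ q = 0 → spectralRadius ℂ (a + q) = 0) :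
    a ∈ Ring.jacobson A := by
  have ha : spectralRadius ℂ a = 0 := by simpa using h 0 (by simp)
  refine Submodule.mem_sInf.2 fun L hL => ?_
  replace hL : IsCoatom L := hL
  by_cases hLa : ∀ x ∈ L, x * a ∈ L
  · obtain ⟨μ, hμ⟩ := exists_sub_algebraMap_mem hL hLa
    have h0 := eq_zero_of_sub_algebraMap_mem_of_spectralRadius_eq_zero hL.1 ha hμ
    simpa [h0] using hμ
  · exfalso
    push Not at hLa
    obtain ⟨x, hx, hxa⟩ := hLa
    have htop : L ⊔ Ideal.span {x * a} = ⊤ := hL.2 _ (by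
      refine lt_of_le_of_ne le_sup_left fun h => hxa ?_
      rw [h]
      exact Submodule.mem_sup_right (Ideal.mem_span_singleton_self _))
    obtain ⟨l, hl, z, hz, hlz⟩ := Submodule.mem_sup.1 (htop ▸ Submodule.mem_top (x := (1 : A)))
    obtain ⟨y, rfl⟩ := Ideal.mem_span_singleton'.1 hz
    -- `u = y * x ∈ L` satisfies `u * a ≡ 1` modulo `L`, so `1` is in the spectrum of `[u, a]`.
    refine one_ne_zero (eq_zero_of_sub_algebraMap_mem_of_spectralRadius_eq_zero (μ := 1) hL.1
      (spectralRadius_commutator_eq_zero h (y * x)) ?_)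
    have h1 : y * x * a - a * (y * x) - algebraMap ℂ A 1 = -l - (a * y) * x := by
      rw [map_one, ← hlz]; noncomm_ring
    rw [h1]
    exact L.sub_mem (L.neg_mem hl) (Ideal.mul_mem_left L _ hx)

end Radical

/-! ### Null sets and non-measurable additive maps -/

section NullSets

open Filter Topology Metric Complex
open scoped ENNReal NNReal
open MeasureTheory
open scoped Pointwise

/-- Ergodicity of translation by a countable dense subgroup: of two disjoint sets, one compact and
the other invariant, one is null. The invariant set need not be measurable. -/
theorem volume_eq_zero_or_of_dense_invariant {Γ : AddSubgroup ℂ} [Countable Γ]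
    (hΓ : Dense (Γ : Set ℂ)) {K F : Set ℂ} (hK : IsCompact K) (hKF : Disjoint K F)
    (hF : ∀ γ ∈ Γ, ∀ x ∈ F, γ + x ∈ F) : volume K = 0 ∨ volume F = 0 := by
  set C : Set ℂ := (⋃ γ : Γ, (γ : ℂ) +ᵥ K)ᶜ with hC
  have hCm : MeasurableSet C :=
    (MeasurableSet.iUnion fun γ : Γ => (hK.vadd (γ : ℂ)).measurableSet).compl
  have hFC : F ⊆ C := by
    intro x hx hx'
    obtain ⟨γ, hγ⟩ := Set.mem_iUnion.1 hx'
    rw [Set.mem_vadd_set_iff_neg_vadd_mem] at hγ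
    exact Set.disjoint_left.1 hKF hγ (hF _ (Γ.neg_mem γ.2) x hx)
  have hzero : ∀ z : ℂ, volume (C ∩ (z +ᵥ K)) = 0 := by
    intro z
    by_contra hpos
    have hev := eventually_nhds_zero_measure_vadd_sdiff_lt (μ := (volume : Measure ℂ)) hK
      hK.isClosed hpos
    have hcont : Tendsto (fun γ : ℂ => z - γ) (𝓝 z) (𝓝 0) := by
      have : Continuous fun γ : ℂ => z - γ := by fun_prop
      simpa using this.tendsto z
    obtain ⟨γ, hγ, hγΓ⟩ := mem_closure_iff_nhds.1 (hΓ z) _ (hcont.eventually hev)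
    refine absurd ((measure_mono ?_).trans_lt
      (((measure_vadd volume γ _).trans_lt hγ))) (lt_irrefl (volume (C ∩ (z +ᵥ K))))
    rintro x ⟨hxC, hxz⟩
    rw [Set.mem_vadd_set_iff_neg_vadd_mem] at hxz ⊢
    refine ⟨?_, fun h => hxC (Set.mem_iUnion.2 ⟨⟨γ, hγΓ⟩, ?_⟩)⟩
    · rw [Set.mem_vadd_set_iff_neg_vadd_mem]
      convert hxz using 1
      simp only [vadd_eq_add]; ring
    · rw [Set.mem_vadd_set_iff_neg_vadd_mem]; exact h
  have hmul : volume C * volume K = 0 := by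
    have hm : Measurable (Function.uncurry fun z x : ℂ =>
        C.indicator (1 : ℂ → ℝ≥0∞) x * K.indicator (1 : ℂ → ℝ≥0∞) (x - z)) :=
      ((measurable_one.indicator hCm).comp measurable_snd).mul
        ((measurable_one.indicator hK.measurableSet).comp (measurable_snd.sub measurable_fst))
    calc volume C * volume K
        = ∫⁻ x : ℂ, ∫⁻ z : ℂ, C.indicator (1 : ℂ → ℝ≥0∞) x *
            K.indicator (1 : ℂ → ℝ≥0∞) (x - z) := by
          have h1 : ∀ x : ℂ, ∫⁻ z : ℂ, K.indicator (1 : ℂ → ℝ≥0∞) (x - z) = volume K := by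
            intro x
            rw [lintegral_sub_left_eq_self (fun z => K.indicator (1 : ℂ → ℝ≥0∞) z),
              lintegral_indicator_one hK.measurableSet]
          have h2 : ∀ x : ℂ, ∫⁻ z : ℂ, C.indicator (1 : ℂ → ℝ≥0∞) x *
              K.indicator (1 : ℂ → ℝ≥0∞) (x - z) =
              C.indicator (1 : ℂ → ℝ≥0∞) x * volume K := by
            intro x
            have hmx : Measurable fun z => K.indicator (1 : ℂ → ℝ≥0∞) (x - z) :=
              (measurable_one.indicator hK.measurableSet).comp (measurable_const.sub measurable_id)
            rw [lintegral_const_mul _ hmx, h1]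
          simp_rw [h2]
          rw [lintegral_mul_const _ (measurable_one.indicator hCm), lintegral_indicator_one hCm]
      _ = ∫⁻ z : ℂ, ∫⁻ x : ℂ, C.indicator (1 : ℂ → ℝ≥0∞) x *
            K.indicator (1 : ℂ → ℝ≥0∞) (x - z) :=
          (lintegral_lintegral_swap hm.aemeasurable).symm
      _ = ∫⁻ z : ℂ, 0 := by
          refine lintegral_congr fun z => ?_
          rw [← hzero z, ← lintegral_indicator_one (hCm.inter (hK.vadd z).measurableSet)]
          refine lintegral_congr fun x => ?_
          have : (x - z ∈ K) ↔ x ∈ z +ᵥ K := by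
            rw [Set.mem_vadd_set_iff_neg_vadd_mem, vadd_eq_add, neg_add_eq_sub]
          by_cases h1 : x ∈ C <;> by_cases h2 : x ∈ z +ᵥ K <;>
            simp [h1, h2, this, Set.indicator]
      _ = 0 := lintegral_zero
  rcases mul_eq_zero.1 hmul with h | h
  · exact Or.inr (measure_mono_null hFC h)
  · exact Or.inl h

/-- An additive map that vanishes on a countable dense subgroup is small near almost every point;
no measurability of the map is assumed. -/
theorem volume_eq_zero_of_lt_norm_addMonoidHom {V : Type*} [NormedAddCommGroup V] [NormedSpace ℝ V]
    {Γ : AddSubgroup ℂ} [Countable Γ] (hΓ : Dense (Γ : Set ℂ)) (D : ℂ →+ V)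
    (hD : ∀ γ ∈ Γ, D γ = 0) {K : Set ℂ} (hK : IsCompact K) {η : ℝ} (hη : 0 < η)
    (hKD : ∀ z ∈ K, η < ‖D z‖) : volume K = 0 := by
  refine (volume_eq_zero_or_of_dense_invariant hΓ hK (F := {z | ‖D z‖ ≤ η})
    (Set.disjoint_left.2 fun z hz hz' => (hKD z hz).not_ge hz') ?_).resolve_right ?_
  · intro γ hγ x hx
    simpa [hD γ hγ] using hx
  · intro h0
    -- By additivity the dilates of `F` cover the plane, so `{z | ‖D z‖ ≤ η}` is not null.
    have hcover : (Set.univ : Set ℂ) ⊆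
        ⋃ k : ℕ, (fun z : ℂ => ((k + 1 : ℕ) : ℝ)⁻¹ • z) ⁻¹' {z | ‖D z‖ ≤ η} := by
      intro z _
      obtain ⟨k, hk⟩ := exists_nat_ge (‖D z‖ / η)
      refine Set.mem_iUnion.2 ⟨k, ?_⟩
      set w := ((k + 1 : ℕ) : ℝ)⁻¹ • z with hw
      have hz : z = (k + 1) • w := by
        rw [hw, ← Nat.cast_smul_eq_nsmul ℝ, smul_inv_smul₀ (by positivity)]
      have h1 : ‖D z‖ = (k + 1) * ‖D w‖ := by
        rw [hz, map_nsmul, ← Nat.cast_smul_eq_nsmul ℝ, norm_smul]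
        simp; left; positivity
      change ‖D w‖ ≤ η
      rw [div_le_iff₀ hη, h1] at hk
      have : 0 ≤ ‖D w‖ := norm_nonneg _
      have hk0 : (0 : ℝ) ≤ k := by positivity
      by_contra! hlt
      nlinarith
    have hnull : volume (Set.univ : Set ℂ) = 0 := by
      refine measure_mono_null hcover (measure_iUnion_null fun k => ?_)
      rw [Measure.addHaar_preimage_smul _ (by positivity), h0, mul_zero]
    simp at hnull

/-- There are arbitrarily small circles around a given point that meet a null set in a null set of
angles. -/
theorem exists_circle_ae_notMem {K : Set ℂ} (hK : MeasurableSet K) (h0 : volume K = 0) (c : ℂ)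
    {ρ : ℝ} (hρ : 0 < ρ) : ∃ R, 0 < R ∧ R < ρ ∧
      ∀ᵐ θ : ℝ, θ ∈ Set.Ioc 0 (2 * Real.pi) → circleMap c R θ ∉ K := by
  -- Polar coordinates use angles in `(-π, π)` and `circleMap` is used on `(0, 2 * π]`; the reflection
  -- `z ↦ c - z` shifts angles by `π`.
  set K' : Set ℂ := (fun z => c - z) ⁻¹' K with hK'
  have hK'm : MeasurableSet K' := (measurable_const.sub measurable_id) hK
  have hK'0 : volume K' = 0 := by
    rw [hK', (Measure.measurePreserving_sub_left volume c).measure_preimage hK.nullMeasurableSet, h0]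
  have hpolar := Complex.lintegral_comp_polarCoord_symm (K'.indicator 1)
  have hsymm : Measurable fun p : ℝ × ℝ => Complex.polarCoord.symm p := by
    simp_rw [Complex.polarCoord_symm_apply]
    fun_prop
  rw [lintegral_indicator_one hK'm, hK'0, lintegral_eq_zero_iff (by
    exact (measurable_fst.ennreal_ofReal).mul ((measurable_one.indicator hK'm).comp hsymm)),
    polarCoord_target, Measure.volume_eq_prod, ← Measure.prod_restrict] at hpolar
  have hae := Measure.ae_ae_of_ae_prod hpolar
  rw [ae_restrict_iff' measurableSet_Ioi] at hae
  obtain ⟨R, hR, hRae⟩ : ∃ R ∈ Set.Ioo 0 ρ, ∀ᵐ θ ∂(volume.restrict (Set.Ioo (-Real.pi) Real.pi)),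
      ENNReal.ofReal R • K'.indicator (1 : ℂ → ℝ≥0∞) (Complex.polarCoord.symm (R, θ)) = 0 := by
    by_contra hcon
    have : volume (Set.Ioo 0 ρ) = 0 := by
      refine measure_mono_null ?_ (ae_iff.1 hae)
      exact fun R hR h => hcon ⟨R, hR, h hR.1⟩
    simp [hρ.not_ge] at this
  refine ⟨R, hR.1, hR.2, ?_⟩
  rw [ae_restrict_iff' measurableSet_Ioo] at hRae
  have hshift := (measurePreserving_sub_right volume Real.pi).quasiMeasurePreserving.ae hRae
  filter_upwards [hshift, compl_mem_ae_iff.2 (measure_singleton (2 * Real.pi))] with θ hθ hne hmem hK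
  have hlt : θ < 2 * Real.pi := lt_of_le_of_ne hmem.2 hne
  have h1 := hθ ⟨by linarith [hmem.1], by linarith⟩
  have h2 : Complex.polarCoord.symm (R, θ - Real.pi) ∈ K' := by
    have : c - Complex.polarCoord.symm (R, θ - Real.pi) = circleMap c R θ := by
      rw [Complex.polarCoord_symm_apply, Real.cos_sub_pi, Real.sin_sub_pi, circleMap,
        Complex.exp_mul_I]
      push_cast
      ring
    rw [hK', Set.mem_preimage, this]
    exact hK
  rw [Set.indicator_of_mem h2] at h1
  simp [hR.1.not_ge] at h1

/-- The Gaussian rationals. -/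
noncomputable def gaussianRationals : AddSubgroup ℂ :=
  (AddMonoidHom.mk' (fun p : ℚ × ℚ => (p.1 : ℂ) + p.2 * I)
    (fun p q => by simp only [Prod.fst_add, Prod.snd_add]; push_cast; ring)).range

instance : Countable gaussianRationals :=
  (Set.countable_range fun p : ℚ × ℚ => (p.1 : ℂ) + p.2 * I).to_subtype

theorem dense_gaussianRationals : Dense (gaussianRationals : Set ℂ) := by
  have h := (equivRealProdCLM.symm.surjective.denseRange).comp
    ((Rat.isDenseEmbedding_coe_real.dense).prodMap Rat.isDenseEmbedding_coe_real.dense)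
    equivRealProdCLM.symm.continuous
  refine h.mono ?_
  rintro _ ⟨p, rfl⟩
  exact ⟨p, by simp [equivRealProdCLM_symm_apply]⟩

end NullSets

/-! ### A Bernstein–Walsh inequality for the spectral radius -/

section Joukowski

open Filter Topology Metric Complex
open scoped ENNReal NNReal

/-- The Joukowski map `ζ ↦ (R / 2) (ζ + ζ⁻¹)` sends the annulus `1 / 2 ≤ ‖ζ‖ ≤ 1` onto a set
containing the disc of radius `R / 2`. -/
theorem exists_joukowski_preimage {R : ℝ} (hR : 0 < R) {z : ℂ} (hz : ‖z‖ ≤ R / 2) :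
    ∃ ζ : ℂ, ‖ζ‖ ≤ 1 ∧ 1 / 2 ≤ ‖ζ‖ ∧ (R / 2 : ℂ) * (ζ ^ 2 + 1) = z * ζ := by
  have hRc : (R : ℂ) ≠ 0 := by exact_mod_cast hR.ne'
  obtain ⟨d, hd⟩ := IsAlgClosed.exists_pow_nat_eq ((z / R) ^ 2 - 1) two_pos
  have hprod : (z / R + d) * (z / R - d) = 1 := by linear_combination -hd
  have main : ∀ ζ ζ' : ℂ, ζ * ζ' = 1 → ζ + ζ' = 2 * (z / R) → ‖ζ‖ ≤ 1 →
      ∃ ζ : ℂ, ‖ζ‖ ≤ 1 ∧ 1 / 2 ≤ ‖ζ‖ ∧ (R / 2 : ℂ) * (ζ ^ 2 + 1) = z * ζ := by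
    intro ζ ζ' h1 h2 h3
    have h4 : 1 = 2 * (z / R) * ζ - ζ ^ 2 := by rw [← h2]; linear_combination -h1
    refine ⟨ζ, h3, ?_, ?_⟩
    · by_contra! hlt
      have h5 : ‖2 * (z / R)‖ ≤ 1 := by
        rw [norm_mul, norm_div, norm_real, Real.norm_of_nonneg hR.le, RCLike.norm_ofNat,
          mul_div_assoc', div_le_one hR]
        linarith
      have h6 : (1 : ℝ) ≤ ‖2 * (z / R)‖ * ‖ζ‖ + ‖ζ‖ ^ 2 := by
        calc (1 : ℝ) = ‖2 * (z / R) * ζ - ζ ^ 2‖ := by rw [← h4, norm_one]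
          _ ≤ _ := (norm_sub_le _ _).trans (by rw [norm_mul, norm_pow])
      nlinarith [norm_nonneg ζ]
    · have h7 : z = R * (z / R) := by field_simp
      linear_combination (R / 2) * h4 - ζ * h7
  rcases le_total ‖z / R + d‖ 1 with h | h
  · exact main _ _ hprod (by ring) h
  · refine main (z / R - d) (z / R + d) (by rw [mul_comm]; exact hprod) (by ring) ?_
    have h8 : ‖z / R + d‖ * ‖z / R - d‖ = 1 := by rw [← norm_mul, hprod, norm_one]
    nlinarith [norm_nonneg (z / R - d)]

variable {A : Type*} [NormedRing A] [NormedAlgebra ℂ A] [CompleteSpace A]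

/-- A Bernstein–Walsh inequality: a bound for the spectral radius of `u + t • v` for `t` in a real
interval extends, up to a factor, to a complex disc. -/
theorem spectralRadius_add_smul_le_of_real {u v : A} {R : ℝ} (hR : 0 < R) {M : ℝ≥0}
    (h : ∀ t : ℝ, |t| ≤ R → spectralRadius ℂ (u + (t : ℂ) • v) < M) {z : ℂ} (hz : ‖z‖ ≤ R / 2) :
    spectralRadius ℂ (u + z • v) ≤ 2 * M := by
  obtain ⟨ζ, h1, h2, h3⟩ := exists_joukowski_preimage hR hz
  have hζ : ζ ≠ 0 := norm_pos_iff.1 (by linarith)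
  -- `p w = w • (u + (R / 2) (w + w⁻¹) • v)`, with the singularity at `0` removed.
  let p : ℂ → A := fun w => w • u + ((R / 2 : ℂ) * (w ^ 2 + 1)) • v
  have hp : Differentiable ℂ p := by fun_prop
  have hsph : ∀ w ∈ sphere (0 : ℂ) 1, spectralRadius ℂ (p w) < M := by
    intro w hw
    have hw1 : ‖w‖ = 1 := by simpa using hw
    -- On the unit circle `w⁻¹` is the conjugate of `w`, so `w + w⁻¹` is real.
    have h4 : p w = w • (u + ((R * w.re : ℝ) : ℂ) • v) := by
      have h5 : w * (starRingEnd ℂ) w = 1 := by rw [mul_conj, normSq_eq_norm_sq, hw1]; simp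
      have h6 : (R / 2 : ℂ) * (w ^ 2 + 1) = w * ((R * w.re : ℝ) : ℂ) := by
        have h7 : ((w.re : ℝ) : ℂ) = (w + (starRingEnd ℂ) w) / 2 := by rw [re_eq_add_conj]
        rw [ofReal_mul, h7]
        linear_combination (-R / 2 : ℂ) * h5
      simp only [p]
      rw [h6, smul_add, smul_smul]
    rw [h4, spectralRadius_smul, show ‖w‖₊ = 1 from NNReal.eq hw1, ENNReal.coe_one, one_mul]
    refine h _ ?_
    rw [abs_mul, abs_of_pos hR]
    exact mul_le_of_le_one_right hR.le ((abs_re_le_norm w).trans hw1.le)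
  have hle : spectralRadius ℂ (p ζ) ≤ M :=
    spectralRadius_le_of_sphere one_ne_zero hp.diffContOnCl hsph (by simpa using h1)
  have hq : u + z • v = ζ⁻¹ • p ζ := by
    simp only [p]
    rw [h3, mul_comm z, ← smul_smul, ← smul_add, inv_smul_smul₀ hζ]
  rw [hq, spectralRadius_smul]
  gcongr
  have : ‖ζ⁻¹‖₊ ≤ 2 := by
    rw [← NNReal.coe_le_coe, coe_nnnorm, norm_inv]
    exact inv_le_of_inv_le₀ (by norm_num) (by simpa using h2)
  exact_mod_cast this

end Joukowski

/-! ### Additive maps preserving the spectral radius -/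

section Additive

open Filter Topology Metric Complex
open scoped ENNReal NNReal

variable {A B : Type*} [NormedRing A] [NormedAlgebra ℂ A] [CompleteSpace A]
  [NormedRing B] [NormedAlgebra ℂ B]

theorem eq_zero_of_spectralRadius_add_eq_zero (hA : Ring.jacobson A = ⊥) {a : A}
    (h : ∀ q : A, spectralRadius ℂ q = 0 → spectralRadius ℂ (a + q) = 0) : a = 0 := by
  simpa [hA] using mem_jacobson_of_spectralRadius_add_eq_zero h

theorem eq_zero_of_addEquiv_of_spectralRadius_add_eq_zero (hA : Ring.jacobson A = ⊥) (T : A ≃+ B)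
    (hr : ∀ x, spectralRadius ℂ (T x) = spectralRadius ℂ x) {b : B}
    (h : ∀ w : B, spectralRadius ℂ w = 0 → spectralRadius ℂ (b + w) = 0) : b = 0 := by
  have : T.symm b = 0 := eq_zero_of_spectralRadius_add_eq_zero hA fun q hq => by
    rw [← hr, map_add, T.apply_symm_apply]
    exact h _ ((hr q).trans hq)
  simpa using this

variable [CompleteSpace B]

/-- Along rational parameters this is immediate from additivity. For real `s`, the bound
`spectralRadius ℂ (T y + z • T x) < ε` holds for almost every `z` near `s`, and subharmonicity
carries it to `s`. -/
theorem spectralRadius_map_add_real_smul_eq_zero (T : A ≃+ B)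
    (hr : ∀ x, spectralRadius ℂ (T x) = spectralRadius ℂ x) {x y : A} {s : ℝ}
    (h : spectralRadius ℂ (y + (s : ℂ) • x) = 0) :
    spectralRadius ℂ (T y + (s : ℂ) • T x) = 0 := by
  rw [← nonpos_iff_eq_zero]
  refine ENNReal.le_of_forall_pos_le_add fun ε hε _ => ?_
  rw [zero_add]
  obtain ⟨δ, hδ, hball⟩ := Metric.eventually_nhds_iff.1
    (eventually_spectralRadius_lt (a := y + (s : ℂ) • x) (c := ε)
      (by rw [h]; exact_mod_cast hε))
  set x' : A := T.symm (I • T x) with hx'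
  -- The deviation of `z ↦ T⁻¹ (z • T x)` from the real-linear map agreeing with it at `1` and `I`.
  let D : ℂ →+ A := AddMonoidHom.mk'
    (fun z => T.symm (z • T x) - ((z.re : ℂ) • x + (z.im : ℂ) • x')) (fun z w => by
      rw [add_smul, map_add, add_re, add_im, ofReal_add, ofReal_add, add_smul, add_smul]; abel)
  have hD : ∀ γ ∈ gaussianRationals, D γ = 0 := by
    rintro _ ⟨⟨p, r⟩, rfl⟩
    have h1 : T.symm (((p : ℂ) + r * I) • T x) = (p : ℂ) • x + (r : ℂ) • x' := by
      rw [add_smul, map_add, mul_smul, map_ratCast_smul T.symm ℂ ℂ, map_ratCast_smul T.symm ℂ ℂ,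
        T.symm_apply_apply]
    simp only [D, AddMonoidHom.mk'_apply]
    rw [h1, sub_eq_zero]
    simp
  let f : ℂ → B := fun z => T y + z • T x
  have hf : Differentiable ℂ f := by fun_prop
  set η : ℝ := δ / 3 with hη
  set ρ : ℝ := η / (‖x‖ + ‖x'‖ + 1) with hρ
  have hη0 : 0 < η := by positivity
  have hρ0 : 0 < ρ := by positivity
  set K : Set ℂ := closedBall (s : ℂ) ρ ∩ {z | spectralRadius ℂ (f z) < ε}ᶜ with hK
  have hKc : IsCompact K := (isCompact_closedBall _ _).inter_right
    ((isOpen_spectralRadius_lt (A := B) ε).preimage hf.continuous).isClosed_compl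
  have hK0 : MeasureTheory.volume K = 0 := by
    refine volume_eq_zero_of_lt_norm_addMonoidHom dense_gaussianRationals D hD hKc hη0 ?_
    rintro z ⟨hz, hzε⟩
    by_contra! hle
    refine hzε ?_
    have h1 : T (y + T.symm (z • T x)) = f z := by simp [f]
    change spectralRadius ℂ (f z) < ε
    rw [← h1, hr]
    refine hball ?_
    have h2 : y + T.symm (z • T x) - (y + (s : ℂ) • x) =
        D z + ((z.re - s : ℝ) : ℂ) • x + (z.im : ℂ) • x' := by
      simp only [D, AddMonoidHom.mk'_apply]
      push_cast
      rw [sub_smul]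
      abel
    have h3 : ‖z - s‖ ≤ ρ := by simpa [dist_eq_norm] using hz
    have h4 : |z.re - s| ≤ ρ := by simpa using (abs_re_le_norm (z - s)).trans h3
    have h5 : |z.im| ≤ ρ := by simpa using (abs_im_le_norm (z - s)).trans h3
    rw [dist_eq_norm, h2]
    have h6 : ρ * (‖x‖ + ‖x'‖ + 1) = η := by rw [hρ]; field_simp
    calc ‖D z + ((z.re - s : ℝ) : ℂ) • x + (z.im : ℂ) • x'‖
        ≤ η + ρ * ‖x‖ + ρ * ‖x'‖ := by
          refine (norm_add₃_le).trans ?_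
          rw [norm_smul, norm_smul, norm_real, norm_real]
          gcongr <;> assumption
      _ < δ := by linarith
  obtain ⟨R, hR0, hRρ, hae⟩ := exists_circle_ae_notMem hKc.measurableSet hK0 (s : ℂ) hρ0
  refine spectralRadius_le_of_ae_circle (f := f) hf hR0 hε ?_
  filter_upwards [hae] with θ hθ hθ'
  by_contra hcon
  refine hθ hθ' ⟨?_, hcon⟩
  exact closedBall_subset_closedBall hRρ.le (circleMap_mem_closedBall _ hR0.le _)

theorem map_real_smul_of_spectralRadius_map_eq (hA : Ring.jacobson A = ⊥) (T : A ≃+ B)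
    (hr : ∀ x, spectralRadius ℂ (T x) = spectralRadius ℂ x) (c : ℝ) (x : A) :
    T ((c : ℂ) • x) = (c : ℂ) • T x := by
  rw [← sub_eq_zero]
  refine eq_zero_of_addEquiv_of_spectralRadius_add_eq_zero hA T hr fun w hw => ?_
  have h1 : T ((c : ℂ) • x) - (c : ℂ) • T x + w =
      T ((c : ℂ) • x + T.symm w) + ((-c : ℝ) : ℂ) • T x := by
    rw [map_add, T.apply_symm_apply, ofReal_neg, neg_smul]; abel
  rw [h1]
  refine spectralRadius_map_add_real_smul_eq_zero T hr ?_
  rw [ofReal_neg, neg_smul, add_neg_cancel_comm, ← hr, T.apply_symm_apply, hw]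

/-- The separating space of `T` is trivial: this is the hypothesis of the closed graph theorem. -/
theorem eq_zero_of_tendsto_map (hA : Ring.jacobson A = ⊥) (T : A ≃+ B)
    (hr : ∀ x, spectralRadius ℂ (T x) = spectralRadius ℂ x) {x : ℕ → A} {b : B}
    (hx : Tendsto x atTop (𝓝 0)) (hTx : Tendsto (fun n => T (x n)) atTop (𝓝 b)) : b = 0 := by
  refine eq_zero_of_addEquiv_of_spectralRadius_add_eq_zero hA T hr fun w hw => ?_
  set c : A := T.symm w + T.symm b with hc
  set M : ℝ≥0 := ‖c‖₊ + 2 with hM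
  have key : ∀ ε : ℝ≥0, 0 < ε → spectralRadius ℂ (b + w) ^ 2 ≤ ε * (2 * M + 1 : ℝ≥0) := by
    intro ε hε
    obtain ⟨δ, hδ, hball⟩ := Metric.eventually_nhds_iff.1
      (eventually_spectralRadius_lt (a := w) (c := ε) (by rw [hw]; exact_mod_cast hε))
    -- On the circle of radius `ρ⁻¹` the term `z • T (x n)` has norm less than `δ / 2`.
    set ρ : ℝ := 2 * (‖b‖ + 1) / δ + 2 with hρ
    have hdiv : 0 < 2 * (‖b‖ + 1) / δ := by positivity
    have hρ1 : 1 < ρ := by linarith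
    have hρ0 : 0 < ρ := by linarith
    have hρδ : ρ⁻¹ * (‖b‖ + 1) < δ / 2 := by
      rw [inv_mul_lt_iff₀ hρ0, hρ]
      have : (2 * (‖b‖ + 1) / δ + 2) * (δ / 2) = ‖b‖ + 1 + δ := by field_simp
      linarith
    obtain ⟨n, hn1, hn2⟩ := ((hx.norm.mul_const (1 + 2 * ρ)).eventually_lt_const
      (u := 1) (by simp)).and ((tendsto_iff_norm_sub_tendsto_zero.1 hTx).eventually_lt_const
      (u := min 1 (δ / 2)) (by positivity)) |>.exists
    have hn3 : ‖T (x n) - b‖ < 1 := hn2.trans_le (min_le_left _ _)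
    have hn4 : ‖T (x n) - b‖ < δ / 2 := hn2.trans_le (min_le_right _ _)
    have hn5 : ‖T (x n)‖ ≤ ‖b‖ + 1 := by
      have := norm_add_le (T (x n) - b) b
      rw [sub_add_cancel] at this
      linarith
    let q : ℂ → B := fun z => (w + b - T (x n)) + z • T (x n)
    have hq : Differentiable ℂ q := by fun_prop
    have hreal : ∀ t : ℝ, |t| ≤ 2 * ρ → spectralRadius ℂ (q t) < M := by
      intro t ht
      have h1 : q t = T (c - x n + (t : ℂ) • x n) := by
        rw [map_add, map_sub, map_real_smul_of_spectralRadius_map_eq hA T hr, hc, map_add,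
          T.apply_symm_apply, T.apply_symm_apply]
      have h2 : ‖c - x n + (t : ℂ) • x n‖₊ < M := by
        rw [← NNReal.coe_lt_coe, coe_nnnorm, hM]
        push_cast
        calc ‖c - x n + (t : ℂ) • x n‖ ≤ ‖c‖ + ‖x n‖ + 2 * ρ * ‖x n‖ := by
              refine (norm_add_le _ _).trans (add_le_add (norm_sub_le _ _) ?_)
              rw [norm_smul, norm_real]
              gcongr
              exact ht
          _ < ‖c‖ + 2 := by linarith
      rw [h1, hr]
      exact (spectralRadius_le_enorm _).trans_lt (by exact_mod_cast h2)
    have hcirc := spectralRadius_sq_le_of_circles hq hρ1 (α := ε) (β := 2 * M + 1) ?_ ?_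
    · have h1 : q 1 = b + w := by simp only [q, one_smul]; abel
      rwa [h1] at hcirc
    · intro z hz
      refine hball ?_
      have h2 : q z - w = -(T (x n) - b) + z • T (x n) := by simp only [q]; abel
      rw [dist_eq_norm, h2]
      calc ‖-(T (x n) - b) + z • T (x n)‖ ≤ ‖T (x n) - b‖ + ρ⁻¹ * (‖b‖ + 1) := by
            refine (norm_add_le _ _).trans ?_
            rw [norm_neg, norm_smul, hz]
            gcongr
        _ < δ := by linarith
    · intro z hz
      refine (spectralRadius_add_smul_le_of_real (by positivity) hreal (z := z)
        (by rw [hz]; linarith)).trans_lt ?_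
      exact_mod_cast lt_add_one (2 * M)
  have hsq : spectralRadius ℂ (b + w) ^ 2 = 0 := by
    rw [← nonpos_iff_eq_zero]
    refine ENNReal.le_of_forall_pos_le_add fun ε hε _ => ?_
    rw [zero_add]
    refine (key (ε / (2 * M + 1)) (by positivity)).trans_eq ?_
    rw [← ENNReal.coe_mul, div_mul_cancel₀ _ (by positivity)]
  exact pow_eq_zero_iff two_ne_zero |>.1 hsq

end Additive

theorem theorem2p6 {A : Type*} {B : Type*}
    [NormedRing A] [NormedAlgebra ℂ A] [CompleteSpace A]
    [NormedRing B] [NormedAlgebra ℂ B] [CompleteSpace B]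
    (hA : Ring.jacobson A = ⊥)
    (T : A →+ B) (hsurj : Function.Surjective T)
    (hr : ∀ x : A, spectralRadius ℂ (T x) = spectralRadius ℂ x) :
    Continuous T ∧ ∀ (c : ℝ) (x : A), T ((c : ℂ) • x) = (c : ℂ) • T x := by
  have hinj : Function.Injective T := by
    rw [injective_iff_map_eq_zero]
    intro x hx
    refine eq_zero_of_spectralRadius_add_eq_zero hA fun q hq => ?_
    rw [← hr, map_add, hx, zero_add, hr, hq]
  let S : A ≃+ B := AddEquiv.ofBijective T ⟨hinj, hsurj⟩
  have hlin : ∀ (c : ℝ) (x : A), T ((c : ℂ) • x) = (c : ℂ) • T x :=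
    map_real_smul_of_spectralRadius_map_eq hA S hr
  refine ⟨?_, hlin⟩
  let L : A →ₗ[ℝ] B := { T with map_smul' := fun c x => hlin c x }
  refine L.continuous_of_seq_closed_graph fun u x y hu hTu => ?_
  rw [← sub_eq_zero]
  refine eq_zero_of_tendsto_map hA S hr (x := fun n => u n - x) ?_ ?_
  · simpa using hu.sub_const x
  · refine (hTu.sub_const (L x)).congr fun n => ?_
    exact (map_sub L (u n) x).symm
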